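/- **Conventions.** All spaces are complex. A unital Banach algebra $A$ is a complete normed unital algebra over $\mathbb C$ with $\|ab\|\le\|a\|\,\|b\|$. A (unital, left) Banach $A$-module is a Banach space $X$ with a unital left $A$-module structure satisfying $\|a\cdot x\|\le\|a\|\,\|x\|$; morphisms are bounded $A$-module maps. A morphism $\psi\colon X_0\to X$ is *small* if every morphism $\varphi\colon Y\to X$ of Banach $A$-modules for which $Y\oplus X_0\to X$, $(y,z)\mapsto\varphi(y)+\psi(z)$, is surjective is itself surjective. A Banach $A$-module $P$ is *strictly projective* if every surjective morphism $\varepsilon\colon Y\to P$ of Banach $A$-modules admits a morphism $\rho\colon P\to Y$ with $\varepsilon\rho=1$. $E\widehat\otimes F$ is the projective tensor product of Banach spaces (for a left Banach module $E$, a left module via $a\cdot(x\otimes y)=(a\cdot x)\otimes y$), and $\ell^1$ is the space of absolutely summable complex sequences. A closed left ideal $I\subset A$ is *topologically nilpotent* if $$S(n)=\sup\{\|r_1r_2\cdots r_n\|^{1/n}: r_1,\dots,r_n\in I,\ \|r_i\|\le 1\}\longrightarrow 0\qquad(n\to\infty).$$ For a closed left ideal $I$ and a Banach $A$-module $X$,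 $I\widehat\otimes_A X$ denotes the quotient of $I\widehat\otimes X$ by the closed linear span of the elements $ab\otimes x-a\otimes b\cdot x$ with $x\in X$, $a\in I$, $b\in A$ and $ab\in I$ (when $I$ is two-sided the last condition is automatic, and this is the usual projective tensor product over $A$). It is a left Banach $A$-module via multiplication on $I$. **Theorem.** Let $I$ be a closed left ideal in a unital Banach algebra $A$, and let $\iota\colon I\to A$ be the inclusion. The following conditions are equivalent. (A) $I$ is topologically nilpotent; (B) for every unital left Banach $A$-module $X$ the morphism of Banach $A$-modules $I\widehat\otimes_A X\to X$, $a\otimes_A x\mapsto a\cdot x$, is small; (C) for every strictly projective unital left Banach $A$-module $P$ the morphism of Banach $A$-modules $I\widehat\otimes_A P\to P$, $a\otimes_A x\mapsto a\cdot x$, is small; (D) the morphism of left Banach $A$-modules $\iota\otimes 1\colon I\widehat\otimes\ell^1\to A\widehat\otimes\ell^1$ is small. -/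

import Mathlib

universe u

noncomputable section

open scoped TensorProduct

/-! ### The projective tensor product of Banach spaces -/

section ProjectiveTensor

variable {A E F Z : Type*}
  [NormedAddCommGroup E] [NormedSpace ℂ E] [NormedAddCommGroup F] [NormedSpace ℂ F]
  [NormedAddCommGroup Z]

/-- The algebraic tensor product `E ⊗ F` over `ℂ`, to be equipped with the projective norm. -/
def AlgTensor (E F : Type*) [NormedAddCommGroup E] [NormedSpace ℂ E]
    [NormedAddCommGroup F] [NormedSpace ℂ F] : Type _ := E ⊗[ℂ] F

namespace AlgTensor

instance : AddCommGroup (AlgTensor E F) := inferInstanceAs (AddCommGroup (E ⊗[ℂ] F))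

/-- A left action on the first factor gives a left action on the tensor product. -/
instance {R : Type*} [Ring R] [Module R E] [SMulCommClass ℂ R E] : Module R (AlgTensor E F) :=
  inferInstanceAs (Module R (E ⊗[ℂ] F))

/-- The elementary tensor `x ⊗ y`. -/
def tmul (x : E) (y : F) : AlgTensor E F := x ⊗ₜ[ℂ] y

theorem smul_tmul {R : Type*} [Ring R] [Module R E] [SMulCommClass ℂ R E] (r : R) (x : E) (y : F) :
    r • tmul x y = tmul (r • x) y := TensorProduct.smul_tmul' r x y

/-- The costs `∑ ‖xᵢ‖ ‖yᵢ‖` of the finite representations `t = ∑ xᵢ ⊗ yᵢ`. -/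
def costs (t : AlgTensor E F) : Set ℝ :=
  {c | ∃ l : List (E × F), (l.map fun p => tmul p.1 p.2).sum = t ∧
    (l.map fun p => ‖p.1‖ * ‖p.2‖).sum = c}

/-- The projective norm `inf ∑ ‖xᵢ‖ ‖yᵢ‖` over all representations `t = ∑ xᵢ ⊗ yᵢ`. -/
def projNorm (t : AlgTensor E F) : ℝ := sInf (costs t)

theorem costs_nonempty (t : AlgTensor E F) : (costs t).Nonempty := by
  refine TensorProduct.induction_on (motive := fun t : E ⊗[ℂ] F => (costs (t : AlgTensor E F)).Nonempty)
    t ⟨0, [], rfl, rfl⟩ (fun x y => ⟨_, [(x, y)], add_zero _, rfl⟩) ?_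
  rintro s t ⟨_, l, hl, rfl⟩ ⟨_, m, hm, rfl⟩
  exact ⟨_, l ++ m, by rw [List.map_append, List.sum_append, hl, hm]; rfl, rfl⟩

theorem costs_nonneg {t : AlgTensor E F} {c : ℝ} (hc : c ∈ costs t) : 0 ≤ c := by
  obtain ⟨l, -, rfl⟩ := hc
  exact List.sum_nonneg (by simp only [List.mem_map]; rintro _ ⟨p, -, rfl⟩; positivity)

theorem projNorm_le {t : AlgTensor E F} {c : ℝ} (hc : c ∈ costs t) : projNorm t ≤ c :=
  csInf_le ⟨0, fun _ h => costs_nonneg h⟩ hc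

theorem projNorm_nonneg (t : AlgTensor E F) : 0 ≤ projNorm t :=
  Real.sInf_nonneg fun _ h => costs_nonneg h

theorem projNorm_tmul_le (x : E) (y : F) : projNorm (tmul x y) ≤ ‖x‖ * ‖y‖ :=
  projNorm_le ⟨[(x, y)], by simp, by simp⟩

theorem projNorm_zero : projNorm (0 : AlgTensor E F) = 0 :=
  le_antisymm (projNorm_le ⟨[], rfl, rfl⟩) (projNorm_nonneg _)

/-- A subadditive function that is bounded on elementary tensors is bounded by the projective
norm. -/
theorem le_projNorm (q : AlgTensor E F → ℝ) (h0 : q 0 ≤ 0) (hadd : ∀ s t, q (s + t) ≤ q s + q t)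
    {C : ℝ} (hC : 0 ≤ C) (hq : ∀ x y, q (tmul x y) ≤ C * (‖x‖ * ‖y‖)) (t : AlgTensor E F) :
    q t ≤ C * projNorm t := by
  have key : ∀ l : List (E × F), q (l.map fun p => tmul p.1 p.2).sum ≤
      C * (l.map fun p => ‖p.1‖ * ‖p.2‖).sum := by
    intro l
    induction l with
    | nil => simpa using h0
    | cons p l ih =>
      simp only [List.map_cons, List.sum_cons, mul_add]
      exact (hadd _ _).trans (add_le_add (hq _ _) ih)
  refine le_of_forall_pos_le_add fun ε hε => ?_
  obtain ⟨c, hc, hlt⟩ := Real.lt_sInf_add_pos (costs_nonempty t)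
    (show 0 < ε / (C + 1) by positivity)
  obtain ⟨l, hl, rfl⟩ := hc
  have h1 := key l
  rw [hl] at h1
  have h2 : C * (ε / (C + 1)) ≤ ε := by
    rw [mul_div_assoc', div_le_iff₀ (by positivity)]
    nlinarith
  calc q t ≤ C * (projNorm t + ε / (C + 1)) := h1.trans (mul_le_mul_of_nonneg_left hlt.le hC)
    _ ≤ C * projNorm t + ε := by rw [mul_add]; linarith

theorem projNorm_add_le (s t : AlgTensor E F) : projNorm (s + t) ≤ projNorm s + projNorm t := by
  refine le_of_forall_pos_le_add fun ε hε => ?_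
  obtain ⟨_, ⟨l, hl, rfl⟩, h1⟩ := Real.lt_sInf_add_pos (costs_nonempty s) (half_pos hε)
  obtain ⟨_, ⟨m, hm, rfl⟩, h2⟩ := Real.lt_sInf_add_pos (costs_nonempty t) (half_pos hε)
  have h3 : projNorm (s + t) ≤ (l.map fun p => ‖p.1‖ * ‖p.2‖).sum +
      (m.map fun p => ‖p.1‖ * ‖p.2‖).sum :=
    projNorm_le ⟨l ++ m, by rw [List.map_append, List.sum_append, hl, hm], by simp⟩
  change _ < projNorm s + _ at h1
  change _ < projNorm t + _ at h2
  linarith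

theorem projNorm_smul_le {R : Type*} [NormedRing R] [Module R E] [SMulCommClass ℂ R E]
    [IsBoundedSMul R E] (r : R) (t : AlgTensor E F) : projNorm (r • t) ≤ ‖r‖ * projNorm t := by
  refine le_projNorm (fun t => projNorm (r • t)) (by simp [projNorm_zero])
    (fun s t => by simpa [smul_add] using projNorm_add_le (r • s) (r • t)) (norm_nonneg r)
    (fun x y => ?_) t
  rw [smul_tmul, ← mul_assoc]
  exact (projNorm_tmul_le _ _).trans
    (mul_le_mul_of_nonneg_right (norm_smul_le r x) (norm_nonneg y))

instance : SeminormedAddCommGroup (AlgTensor E F) :=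
  AddGroupSeminorm.toSeminormedAddCommGroup
    { toFun := projNorm
      map_zero' := projNorm_zero
      add_le' := projNorm_add_le
      neg' := fun t => by
        have h : ∀ t : AlgTensor E F, projNorm (-t) ≤ projNorm t := fun t => by
          simpa using projNorm_smul_le (-1 : ℂ) t
        exact le_antisymm (h t) (by simpa using h (-t)) }

theorem norm_def (t : AlgTensor E F) : ‖t‖ = projNorm t := rfl

instance : NormedSpace ℂ (AlgTensor E F) where
  norm_smul_le := projNorm_smul_le

instance {R : Type*} [NormedRing R] [Module R E] [SMulCommClass ℂ R E] [IsBoundedSMul R E] :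
    IsBoundedSMul R (AlgTensor E F) :=
  .of_norm_smul_le projNorm_smul_le

instance [Ring A] [Algebra ℂ A] [Module A E] [IsScalarTower ℂ A E] :
    IsScalarTower ℂ A (AlgTensor E F) :=
  inferInstanceAs (IsScalarTower ℂ A (E ⊗[ℂ] F))

theorem norm_map_le {R : Type*} [Ring R] [Module R E] [SMulCommClass ℂ R E] [Module R Z]
    (g : AlgTensor E F →ₗ[R] Z) {C : ℝ} (hC : 0 ≤ C)
    (h : ∀ x y, ‖g (tmul x y)‖ ≤ C * (‖x‖ * ‖y‖)) (t : AlgTensor E F) : ‖g t‖ ≤ C * ‖t‖ :=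
  le_projNorm (fun t => ‖g t‖) (by simp) (fun s t => by simpa using norm_add_le (g s) (g t)) hC h t

end AlgTensor

/-- The projective tensor product `E ⊗̂ F` of Banach spaces: the completion of the algebraic tensor
product in the projective norm. If `E` is a left Banach `A`-module then so is `E ⊗̂ F`, with
`a • (x ⊗ y) = (a • x) ⊗ y`. -/
abbrev ProjTensor (E F : Type*) [NormedAddCommGroup E] [NormedSpace ℂ E]
    [NormedAddCommGroup F] [NormedSpace ℂ F] : Type _ :=
  UniformSpace.Completion (AlgTensor E F)

namespace ProjTensor

/-- The elementary tensor `x ⊗ y` in `E ⊗̂ F`. -/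
def tmul (x : E) (y : F) : ProjTensor E F := (AlgTensor.tmul x y : AlgTensor E F)

variable [NormedRing A] [NormedAlgebra ℂ A] [Module A E] [IsScalarTower ℂ A E] [IsBoundedSMul A E]
  [Module A Z] [IsBoundedSMul A Z] [CompleteSpace Z]

/-- Extension by continuity of a bounded module map from `E ⊗ F` to `E ⊗̂ F`. -/
def lift (g : AlgTensor E F →ₗ[A] Z) (C : ℝ) (hC : 0 ≤ C)
    (h : ∀ x y, ‖g (AlgTensor.tmul x y)‖ ≤ C * (‖x‖ * ‖y‖)) : ProjTensor E F →L[A] Z :=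
  (g.mkContinuous C (AlgTensor.norm_map_le g hC h)).extend UniformSpace.Completion.toComplL

theorem lift_coe (g : AlgTensor E F →ₗ[A] Z) (C : ℝ) (hC : 0 ≤ C)
    (h : ∀ x y, ‖g (AlgTensor.tmul x y)‖ ≤ C * (‖x‖ * ‖y‖)) (t : AlgTensor E F) :
    lift g C hC h (t : ProjTensor E F) = g t :=
  ContinuousLinearMap.extend_eq (e := UniformSpace.Completion.toComplL)
    (g.mkContinuous C (AlgTensor.norm_map_le g hC h)) UniformSpace.Completion.denseRange_coe
    (UniformSpace.Completion.isUniformInducing_coe _) t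

end ProjTensor

end ProjectiveTensor

section BanachModules

variable {A : Type u} [NormedRing A] [NormedAlgebra ℂ A]

/-! ### Small morphisms, strictly projective modules, topological nilpotence -/

/-- A morphism `ψ : X₀ → X` of left Banach `A`-modules is small if every morphism `φ : Y → X` of
left Banach `A`-modules such that `Y ⊕ X₀ → X`, `(y, z) ↦ φ y + ψ z`, is surjective is itself
surjective. -/
def IsSmallMorphism {X₀ X : Type u}
    [NormedAddCommGroup X₀] [NormedSpace ℂ X₀] [CompleteSpace X₀]
    [Module A X₀] [IsScalarTower ℂ A X₀] [IsBoundedSMul A X₀]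
    [NormedAddCommGroup X] [NormedSpace ℂ X] [CompleteSpace X]
    [Module A X] [IsScalarTower ℂ A X] [IsBoundedSMul A X]
    (ψ : X₀ →L[A] X) : Prop :=
  ∀ (Y : Type u) [NormedAddCommGroup Y] [NormedSpace ℂ Y] [CompleteSpace Y]
    [Module A Y] [IsScalarTower ℂ A Y] [IsBoundedSMul A Y] (φ : Y →L[A] X),
    Function.Surjective (fun p : Y × X₀ => φ p.1 + ψ p.2) → Function.Surjective φ

variable (A) in
/-- A left Banach `A`-module `P` is strictly projective if every surjective morphism of left Banach
`A`-modules onto `P` has a right inverse morphism. -/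
def IsStrictlyProjective (P : Type u) [NormedAddCommGroup P] [NormedSpace ℂ P] [CompleteSpace P]
    [Module A P] [IsScalarTower ℂ A P] [IsBoundedSMul A P] : Prop :=
  ∀ (Y : Type u) [NormedAddCommGroup Y] [NormedSpace ℂ Y] [CompleteSpace Y]
    [Module A Y] [IsScalarTower ℂ A Y] [IsBoundedSMul A Y] (ε : Y →L[A] P),
    Function.Surjective ε → ∃ ρ : P →L[A] Y, ε.comp ρ = ContinuousLinearMap.id A P

/-- `S(n) = sup ‖r₁ r₂ ⋯ rₙ‖^(1/n)` over `r₁, …, rₙ` in the unit ball of `I` (for `n ≥ 1`). -/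
def nilpotenceRate (I : Ideal A) (n : ℕ) : ℝ :=
  sSup {s | ∃ r : Fin n → A, (∀ i, r i ∈ I ∧ ‖r i‖ ≤ 1) ∧
    s = ‖(List.ofFn r).prod‖ ^ (1 / (n : ℝ))}

/-- The left ideal `I`, as a normed algebra, is topologically nilpotent: `S(n) → 0`. -/
def IsTopologicallyNilpotentIdeal (I : Ideal A) : Prop :=
  Filter.Tendsto (nilpotenceRate I) Filter.atTop (nhds 0)

/-! ### The morphism `I ⊗̂_A X → X` -/

instance (I : Ideal A) : IsBoundedSMul A I :=
  .of_norm_smul_le fun a x => norm_smul_le a (x : A)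

section

variable (I : Ideal A) (X : Type*) [NormedAddCommGroup X] [NormedSpace ℂ X]
  [Module A X] [IsScalarTower ℂ A X]

/-- The closed submodule of `I ⊗̂ X` generated by the elements `ab ⊗ x - a ⊗ bx` with `x ∈ X`,
`a ∈ I` and `b ∈ A` such that `ab ∈ I`. If `I` is two-sided, `ab ∈ I` holds automatically. The set
of these elements is stable under left multiplication by `A`, so its closed linear span over `ℂ` is
the same. -/
def balancedSubmodule : Submodule A (ProjTensor I X) :=
  (Submodule.span A {t | ∃ (a : I) (b : A) (hab : (a : A) * b ∈ I) (x : X),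
    t = ProjTensor.tmul (⟨(a : A) * b, hab⟩ : I) x - ProjTensor.tmul a (b • x)}).topologicalClosure

instance : IsClosed (balancedSubmodule I X : Set (ProjTensor I X)) :=
  Submodule.isClosed_topologicalClosure _

/-- The projective tensor product `I ⊗̂_A X` over `A`. -/
abbrev BalancedTensor : Type _ := ProjTensor I X ⧸ balancedSubmodule I X

instance : IsBoundedSMul A (BalancedTensor I X) :=
  .of_norm_smul_le fun a x => by
    refine le_of_forall_pos_le_add fun ε hε => ?_
    obtain ⟨m, rfl, hm⟩ := Submodule.Quotient.norm_mk_lt x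
      (show 0 < ε / (‖a‖ + 1) by positivity)
    have h2 : ‖a‖ * (ε / (‖a‖ + 1)) ≤ ε := by
      rw [mul_div_assoc', div_le_iff₀ (by positivity)]
      nlinarith [norm_nonneg a]
    calc ‖a • (Submodule.Quotient.mk m : BalancedTensor I X)‖
        ≤ ‖a • m‖ := by
          rw [← Submodule.Quotient.mk_smul]; exact Submodule.Quotient.norm_mk_le _ _
      _ ≤ ‖a‖ * ‖m‖ := norm_smul_le a m
      _ ≤ _ := by nlinarith [mul_le_mul_of_nonneg_left hm.le (norm_nonneg a)]

variable {X} in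
/-- The algebraic map `I ⊗ X → X`, `a ⊗ x ↦ a • x`. -/
def actionAlg : AlgTensor I X →ₗ[A] X :=
  TensorProduct.AlgebraTensorModule.lift (R := ℂ) (A := A) (M := I) (N := X) (P := X)
    { toFun := fun a =>
        { toFun := fun x => (a : A) • x
          map_add' := fun x y => smul_add _ x y
          map_smul' := fun c x => smul_comm (a : A) c x }
      map_add' := fun a b => by ext x; exact add_smul (a : A) (b : A) x
      map_smul' := fun b a => by ext x; exact mul_smul b (a : A) x }

variable {X} in
theorem actionAlg_tmul (a : I) (x : X) : actionAlg I (AlgTensor.tmul a x) = (a : A) • x := rfl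

variable [CompleteSpace X] [IsBoundedSMul A X]

/-- The morphism `I ⊗̂ X → X`, `a ⊗ x ↦ a • x`. -/
def actionMap : ProjTensor I X →L[A] X :=
  ProjTensor.lift (actionAlg I) 1 zero_le_one fun a x => by
    rw [actionAlg_tmul, one_mul]; exact norm_smul_le (a : A) x

theorem actionMap_tmul (a : I) (x : X) : actionMap I X (ProjTensor.tmul a x) = (a : A) • x :=
  ProjTensor.lift_coe ..

theorem balancedSubmodule_le_ker : balancedSubmodule I X ≤ (actionMap I X).ker := by
  refine Submodule.topologicalClosure_minimal _ (Submodule.span_le.2 ?_)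
    (actionMap I X).isClosed_ker
  rintro _ ⟨a, b, hab, x, rfl⟩
  simp [actionMap_tmul, mul_smul]

/-- The morphism `I ⊗̂_A X → X`, `a ⊗_A x ↦ a • x`. -/
def balancedActionMap : BalancedTensor I X →L[A] X :=
  (balancedSubmodule I X).liftQL (actionMap I X) (balancedSubmodule_le_ker I X)

theorem balancedActionMap_mk (a : I) (x : X) :
    balancedActionMap I X (Submodule.Quotient.mk (ProjTensor.tmul a x)) = (a : A) • x :=
  actionMap_tmul I X a x

end

/-! ### The morphism `ι ⊗ 1 : I ⊗̂ ℓ¹ → A ⊗̂ ℓ¹` -/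

/-- The Banach space `ℓ¹` of absolutely summable sequences of complex numbers. -/
abbrev EllOne : Type := lp (fun _ : ℕ => ℂ) 1

/-- The morphism `ι ⊗ 1 : I ⊗̂ F → A ⊗̂ F`, `a ⊗ y ↦ a ⊗ y`, where `ι : I → A` is the inclusion. -/
def inclusionTensor (I : Ideal A) (F : Type*) [NormedAddCommGroup F] [NormedSpace ℂ F] :
    ProjTensor I F →L[A] ProjTensor A F :=
  ProjTensor.lift
    ((UniformSpace.Completion.toComplL (𝕜 := A) (E := AlgTensor A F)).toLinearMap.comp
      (TensorProduct.AlgebraTensorModule.map (R := ℂ) (A := A) I.subtype (LinearMap.id : F →ₗ[ℂ] F) :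
        AlgTensor I F →ₗ[A] AlgTensor A F)) 1 zero_le_one fun a y => by
    rw [one_mul]
    exact (UniformSpace.Completion.norm_coe _).trans_le (AlgTensor.projNorm_tmul_le (a : A) y)

theorem inclusionTensor_tmul (I : Ideal A) (F : Type*) [NormedAddCommGroup F] [NormedSpace ℂ F]
    (a : I) (y : F) :
    inclusionTensor I F (ProjTensor.tmul a y) = ProjTensor.tmul (a : A) y :=
  ProjTensor.lift_coe ..

end BanachModules

end

/-! The implications run in a cycle (A) → (B) → (C) → (D) → (A), and (B) → (C) is a specialisation.
(A) → (B) is a duality argument. If `φ` and `I ⊗̂_A X → X` are jointly onto, the open mapping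
theorem gives `C` such that every real functional `f` is bounded by `C` times the norm of `f ∘ φ`
plus `C` times the bound of the translates `f (a • ·)`, `a` in the unit ball of `I`. Applying this
to the translates themselves, `n` times, gives `‖f‖ ≤ K ‖f ∘ φ‖ + C ^ n S(n) ^ n ‖f‖`
(`abs_le_of_translate_bound`). Once `C S(n) ≤ 1/2` the last term is absorbed, so the adjoint of `φ`
is bounded below and `φ` is onto (`ContinuousLinearMap.surjective_of_dual_bound`). (C) → (D): `A ⊗̂
ℓ¹` is strictly projective, and smallness passes to any morphism with a smaller range. (D) → (A): on
the free module with basis `e (n, i)`, let `T` send `e (n, i)` to `r n i • e (n, i + 1)`. It factors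
through `I ⊗̂ ℓ¹`, so smallness makes `1 - T` onto. The solution of `v - T v = e (n, 0)` has the
partial products of row `n` as coordinates, and the open mapping theorem bounds them uniformly in
`n` (`exists_bound_prod_of_isSmallMorphism`). Since the entries may first be rescaled by any
constant, `S(n) → 0`. -/

noncomputable section

open scoped TensorProduct

/-! ### Surjectivity from approximation and from a bound on the adjoint -/

section Surjectivity

/-- If every vector is approximated, up to half its norm, by the image of a vector of controlled
norm, then a bounded linear map from a Banach space is surjective. -/
theorem ContinuousLinearMap.surjective_of_approx {Y X : Type*} [NormedAddCommGroup Y]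
    [NormedSpace ℝ Y] [CompleteSpace Y] [NormedAddCommGroup X] [NormedSpace ℝ X]
    (φ : Y →L[ℝ] X) (K : ℝ)
    (h : ∀ x, ∃ y, ‖y‖ ≤ K * ‖x‖ ∧ ‖x - φ y‖ ≤ 1 / 2 * ‖x‖) : Function.Surjective φ := by
  choose g hg hφ using h
  intro x
  -- `u n` is the error left after `n` corrections. It halves each time, so the corrections `g (u
  -- n)` form an absolutely convergent series whose image telescopes to `x`.
  let u : ℕ → X := fun n => (fun x => x - φ (g x))^[n] x
  have hu : ∀ n, u (n + 1) = u n - φ (g (u n)) := fun n => Function.iterate_succ_apply' _ _ _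
  have hun : ∀ n, ‖u n‖ ≤ (1 / 2) ^ n * ‖x‖ := by
    intro n
    induction n with
    | zero => simp [u]
    | succ n ih =>
      rw [hu, pow_succ']
      have := hφ (u n)
      linarith
  have hK : ∀ n, ‖g (u n)‖ ≤ |K| * ((1 / 2) ^ n * ‖x‖) := fun n =>
    (hg _).trans (mul_le_mul (le_abs_self K) (hun n) (norm_nonneg _) (abs_nonneg K))
  have hs : Summable fun n => g (u n) := .of_norm_bounded
    ((summable_geometric_two.mul_right ‖x‖).mul_left |K|) hK
  have hsum : ∀ n, ∑ i ∈ Finset.range n, φ (g (u i)) = x - u n := by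
    intro n
    induction n with
    | zero => simp [u]
    | succ n ih => rw [Finset.sum_range_succ, ih, hu]; abel
  have h0 : Filter.Tendsto u Filter.atTop (nhds 0) := by
    refine squeeze_zero_norm hun ?_
    simpa using (tendsto_pow_atTop_nhds_zero_of_lt_one (r := (1 / 2 : ℝ)) (by norm_num)
      (by norm_num)).mul_const ‖x‖
  refine ⟨∑' n, g (u n), ?_⟩
  refine tendsto_nhds_unique (φ.hasSum hs.hasSum).tendsto_sum_nat ?_
  simp only [hsum]
  simpa using h0.const_sub x

/-- A bounded linear map from a Banach space whose adjoint is bounded below is surjective. -/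
theorem ContinuousLinearMap.surjective_of_dual_bound {Y X : Type*} [NormedAddCommGroup Y]
    [NormedSpace ℝ Y] [CompleteSpace Y] [NormedAddCommGroup X] [NormedSpace ℝ X]
    (φ : Y →L[ℝ] X) (K : ℝ) (h : ∀ f : X →L[ℝ] ℝ, ‖f‖ ≤ K * ‖f.comp φ‖) :
    Function.Surjective φ := by
  refine φ.surjective_of_approx (|K| + 1) fun x => ?_
  obtain rfl | hx := eq_or_ne x 0
  · exact ⟨0, by simp⟩
  have hx' : 0 < ‖x‖ := norm_pos_iff.2 hx
  set r : ℝ := (|K| + 1) * ‖x‖ with hr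
  have hr0 : 0 < r := by positivity
  -- Otherwise some `f` is below `c` on the image of the `r`-ball and above `c` at `x`. Then `‖f ∘
  -- φ‖ ≤ c / r`, so `f x ≤ |K| (c / r) ‖x‖ ≤ c`, a contradiction. The `+ 1` in `r` keeps the radius
  -- positive when `K = 0`.
  have hmem : x ∈ closure (φ '' Metric.closedBall 0 r) := by
    by_contra hmem
    obtain ⟨f, c, hc, hcx⟩ := geometric_hahn_banach_closed_point
      (((convex_closedBall (0 : Y) r).linear_image φ.toLinearMap).closure) isClosed_closure hmem
    have hb : ∀ y, ‖y‖ ≤ r → f (φ y) < c := fun y hy =>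
      hc _ (subset_closure ⟨y, by simpa using hy, rfl⟩)
    have hc0 : 0 < c := by simpa using hb 0 (by simpa using hr0.le)
    have hnorm : ‖f.comp φ‖ ≤ c / r := by
      refine ContinuousLinearMap.opNorm_bound_of_ball_bound hr0 c _ fun y hy => ?_
      have hy' : ‖y‖ ≤ r := by simpa using hy
      have h1 := hb y hy'
      have h2 := hb (-y) (by rwa [norm_neg])
      rw [map_neg, map_neg] at h2
      exact abs_le.2 ⟨by change -c ≤ f (φ y); linarith, h1.le⟩
    have h1 : f x ≤ ‖f‖ * ‖x‖ := (le_abs_self _).trans (f.le_opNorm x)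
    have h2 : ‖f‖ ≤ |K| * (c / r) :=
      (h f).trans (mul_le_mul (le_abs_self K) hnorm (norm_nonneg _) (abs_nonneg K))
    have h3 : f x ≤ |K| * (c / r) * ‖x‖ := h1.trans (mul_le_mul_of_nonneg_right h2 hx'.le)
    have h4 : |K| * (c / r) * ‖x‖ ≤ c := by
      rw [hr]
      field_simp
      nlinarith [abs_nonneg K]
    linarith
  obtain ⟨_, ⟨y, hy, rfl⟩, hxy⟩ := Metric.mem_closure_iff.1 hmem (1 / 2 * ‖x‖) (by positivity)
  exact ⟨y, by simpa using hy, by rw [← dist_eq_norm]; exact hxy.le⟩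

end Surjectivity

/-! ### Products in the unit ball of `I` and the rate `S(n)` -/

section Nilpotent

variable {A : Type u} [NormedRing A]

/-- The empty product must be excluded, because `‖1‖ ≤ 1` is not assumed. -/
theorem norm_prod_ofFn_le_one {n : ℕ} (hn : n ≠ 0) (r : Fin n → A) (hr : ∀ i, ‖r i‖ ≤ 1) :
    ‖(List.ofFn r).prod‖ ≤ 1 := by
  induction n with
  | zero => exact absurd rfl hn
  | succ n ih =>
    rw [List.ofFn_succ, List.prod_cons]
    obtain rfl | hn' := eq_or_ne n 0
    · simpa using hr 0
    · exact (norm_mul_le _ _).trans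
        (mul_le_one₀ (hr 0) (norm_nonneg _) (ih hn' _ fun i => hr i.succ))

theorem bddAbove_nilpotenceRate (I : Ideal A) {n : ℕ} (hn : n ≠ 0) :
    BddAbove {s | ∃ r : Fin n → A, (∀ i, r i ∈ I ∧ ‖r i‖ ≤ 1) ∧
      s = ‖(List.ofFn r).prod‖ ^ (1 / (n : ℝ))} := by
  refine ⟨1, ?_⟩
  rintro _ ⟨r, hr, rfl⟩
  exact Real.rpow_le_one (norm_nonneg _) (norm_prod_ofFn_le_one hn r fun i => (hr i).2)
    (by positivity)

theorem nilpotenceRate_nonneg (I : Ideal A) (n : ℕ) : 0 ≤ nilpotenceRate I n := by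
  refine Real.sSup_nonneg ?_
  rintro _ ⟨r, -, rfl⟩
  positivity

theorem norm_prod_ofFn_le_nilpotenceRate_pow (I : Ideal A) {n : ℕ} (hn : n ≠ 0) (r : Fin n → A)
    (hr : ∀ i, r i ∈ I ∧ ‖r i‖ ≤ 1) : ‖(List.ofFn r).prod‖ ≤ nilpotenceRate I n ^ n := by
  have h : ‖(List.ofFn r).prod‖ ^ (1 / (n : ℝ)) ≤ nilpotenceRate I n :=
    le_csSup (bddAbove_nilpotenceRate I hn) ⟨r, hr, rfl⟩
  have h2 := pow_le_pow_left₀ (by positivity) h n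
  rwa [one_div, Real.rpow_inv_natCast_pow (norm_nonneg _) hn] at h2

/-- Topological nilpotence follows if, after arbitrary rescaling, the `n`-fold products of any
choice of `n`-tuples from the unit ball of `I` stay bounded. -/
theorem isTopologicallyNilpotentIdeal_of_bounded (I : Ideal A)
    (h : ∀ C : ℝ, 0 < C → ∀ r : ∀ n : ℕ, Fin n → A, (∀ n i, r n i ∈ I ∧ ‖r n i‖ ≤ 1) →
      ∃ K : ℝ, ∀ n, C ^ n * ‖(List.ofFn (r n)).prod‖ ≤ K) :
    IsTopologicallyNilpotentIdeal I := by
  have hex : ∀ n : ℕ, ∃ r : Fin n → A, (∀ i, r i ∈ I ∧ ‖r i‖ ≤ 1) ∧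
      nilpotenceRate I n / 2 ≤ ‖(List.ofFn r).prod‖ ^ (1 / (n : ℝ)) := by
    intro n
    obtain h0 | h0 := (nilpotenceRate_nonneg I n).eq_or_lt
    · exact ⟨0, by simp, by rw [← h0, zero_div]; positivity⟩
    · obtain ⟨_, ⟨r, hr, rfl⟩, hlt⟩ := exists_lt_of_lt_csSup
        (s := {s | ∃ r : Fin n → A, (∀ i, r i ∈ I ∧ ‖r i‖ ≤ 1) ∧
          s = ‖(List.ofFn r).prod‖ ^ (1 / (n : ℝ))}) ⟨_, 0, by simp, rfl⟩ (half_lt_self h0)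
      exact ⟨r, hr, hlt.le⟩
  choose r hr hrate using hex
  rw [IsTopologicallyNilpotentIdeal, Metric.tendsto_atTop]
  intro ε hε
  -- If `S(n) ≥ ε`, the near-extremal product has norm at least `(ε / 2) ^ n`. The factor `4 / ε`
  -- turns this into `2 ^ n ≤ K`, which fails for large `n`.
  obtain ⟨K, hK⟩ := h (4 / ε) (by positivity) r hr
  obtain ⟨N, hN⟩ := pow_unbounded_of_one_lt K (one_lt_two)
  refine ⟨N + 1, fun n hn => ?_⟩
  have hn0 : n ≠ 0 := by omega
  rw [Real.dist_eq, sub_zero, abs_of_nonneg (nilpotenceRate_nonneg I n)]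
  by_contra! hle
  have h1 : ε / 2 ≤ ‖(List.ofFn (r n)).prod‖ ^ (1 / (n : ℝ)) :=
    (div_le_div_of_nonneg_right hle two_pos.le).trans (hrate n)
  have h2 := pow_le_pow_left₀ (by positivity) h1 n
  rw [one_div, Real.rpow_inv_natCast_pow (norm_nonneg _) hn0] at h2
  have h3 : (2 : ℝ) ^ n ≤ K := by
    calc (2 : ℝ) ^ n = (4 / ε) ^ n * (ε / 2) ^ n := by
          rw [← mul_pow]; congr 1; field_simp; norm_num
      _ ≤ (4 / ε) ^ n * ‖(List.ofFn (r n)).prod‖ := by gcongr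
      _ ≤ K := hK n
  have h4 : (2 : ℝ) ^ N ≤ 2 ^ n := pow_le_pow_right₀ one_le_two (by omega)
  linarith

end Nilpotent

/-! ### Topological nilpotence implies smallness -/

section SmallOfNilpotent

/-- Iteration of a bound of functionals in terms of their restriction along `φ` and their
translates by elements of the unit ball of `I`. -/
theorem abs_le_of_translate_bound {A : Type u} [NormedRing A] (I : Ideal A)
    {X Y : Type*} [NormedAddCommGroup X] [Module A X] [IsBoundedSMul A X] [NormedAddCommGroup Y]
    [Module A Y] [IsBoundedSMul A Y] (φ : Y →L[A] X) {C : ℝ} (hC : 0 ≤ C)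
    (h : ∀ f : X →+ ℝ, Continuous f → ∀ D M : ℝ, 0 ≤ D → 0 ≤ M → (∀ y, |f (φ y)| ≤ D * ‖y‖) →
      (∀ a ∈ I, ‖a‖ ≤ 1 → ∀ x, |f (a • x)| ≤ M * ‖x‖) → ∀ x, |f x| ≤ (C * D + C * M) * ‖x‖)
    (n : ℕ) : ∃ K : ℝ, 0 ≤ K ∧ ∀ f : X →+ ℝ, Continuous f → ∀ D M : ℝ, 0 ≤ D → 0 ≤ M →
      (∀ y, |f (φ y)| ≤ D * ‖y‖) →
      (∀ r : Fin n → A, (∀ i, r i ∈ I ∧ ‖r i‖ ≤ 1) →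
        ∀ x, |f ((List.ofFn r).prod • x)| ≤ M * ‖x‖) →
      ∀ x, |f x| ≤ (K * D + C ^ n * M) * ‖x‖ := by
  induction n with
  | zero =>
    exact ⟨0, le_rfl, fun f _ D M _ _ _ hr x => by simpa using hr 0 (by simp) x⟩
  | succ n ih =>
    obtain ⟨K, hK, ih⟩ := ih
    refine ⟨C + C * K, by positivity, fun f hf D M hD hM hφ hr x => ?_⟩
    refine (h f hf D (K * D + C ^ n * M) hD (by positivity) hφ (fun a ha ha1 => ?_) x).trans_eq
      (by ring)
    -- The induction hypothesis is applied to the translate `f (a • ·)`. Its bound along `φ` is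
    -- still `D`, since `φ` commutes with `a` and `‖a‖ ≤ 1`; its `n`-fold translates are `(n +
    -- 1)`-fold translates of `f` with first factor `a`.
    refine ih (f.comp (DistribSMul.toAddMonoidHom X a)) (hf.comp (continuous_const_smul a)) D M
      hD hM (fun y => ?_) (fun r hrI x => ?_)
    · have h1 := hφ (a • y)
      rw [map_smul] at h1
      refine h1.trans (mul_le_mul_of_nonneg_left ((norm_smul_le a y).trans ?_) hD)
      exact mul_le_of_le_one_left (norm_nonneg y) ha1
    · have h1 := hr (Fin.cons a r) (fun i => by
        refine Fin.cases ⟨ha, ha1⟩ (fun j => ?_) i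
        simpa using hrI j) x
      simpa [List.ofFn_succ, mul_smul] using h1

variable {A : Type u} [NormedRing A] [NormedAlgebra ℂ A] (I : Ideal A) {X : Type*}
  [NormedAddCommGroup X] [NormedSpace ℂ X] [CompleteSpace X]
  [Module A X] [IsScalarTower ℂ A X] [IsBoundedSMul A X]

/-- A continuous additive functional that is bounded by `M` on products `a • x`, with `a` in the
unit ball of `I`, has bound `M` after composition with `I ⊗̂_A X → X`. -/
theorem abs_comp_balancedActionMap_le (f : X →+ ℝ) (hf : Continuous f) {M : ℝ} (hM : 0 ≤ M)
    (h : ∀ a ∈ I, ‖a‖ ≤ 1 → ∀ x, |f (a • x)| ≤ M * ‖x‖) (z : BalancedTensor I X) :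
    |f (balancedActionMap I X z)| ≤ M * ‖z‖ := by
  have hax : ∀ a ∈ I, ∀ x, |f (a • x)| ≤ M * (‖a‖ * ‖x‖) := by
    intro a ha x
    obtain rfl | ha0 := eq_or_ne a 0
    · simp
    have hna : ‖a‖ ≠ 0 := norm_ne_zero_iff.2 ha0
    have hc : ((‖a‖ : ℂ)) ≠ 0 := by exact_mod_cast hna
    -- As `f` is only additive, the scalar cannot be pulled out of it. Instead it is moved across
    -- the action: `a • x = (‖a‖⁻¹ a) • (‖a‖ x)`.
    have key := h (((‖a‖ : ℂ)⁻¹) • a) (by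
        rw [← smul_one_mul ((‖a‖ : ℂ)⁻¹) a]; exact I.mul_mem_left _ ha)
      (by rw [norm_smul, norm_inv, Complex.norm_real, norm_norm, inv_mul_cancel₀ hna])
      ((‖a‖ : ℂ) • x)
    rwa [smul_assoc, smul_comm a, smul_smul, inv_mul_cancel₀ hc, one_smul, norm_smul,
      Complex.norm_real, norm_norm] at key
  have hw : ∀ w : ProjTensor I X, |f (actionMap I X w)| ≤ M * ‖w‖ := by
    intro w
    induction w using UniformSpace.Completion.induction_on with
    | hp =>
      exact isClosed_le (hf.comp (actionMap I X).continuous).abs (continuous_const.mul continuous_norm)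
    | ih t =>
      rw [UniformSpace.Completion.norm_coe, actionMap, ProjTensor.lift_coe]
      refine AlgTensor.le_projNorm (fun t => |f (actionAlg I t)|) (by simp)
        (fun s t => by simpa using abs_add_le (f (actionAlg I s)) (f (actionAlg I t))) hM
        (fun a x => ?_) t
      rw [actionAlg_tmul]
      exact hax a a.2 x
  refine le_of_forall_pos_le_add fun ε hε => ?_
  obtain ⟨w, rfl, hlt⟩ := Submodule.Quotient.norm_mk_lt z (show 0 < ε / (M + 1) by positivity)
  have h2 : M * (ε / (M + 1)) ≤ ε := by
    rw [mul_div_assoc', div_le_iff₀ (by positivity)]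
    nlinarith
  calc |f (actionMap I X w)| ≤ M * ‖w‖ := hw w
    _ ≤ _ := by nlinarith [mul_le_mul_of_nonneg_left hlt.le hM]

/-- The open mapping theorem gives the one-step estimate `hstep`. Its `n`-fold iterate costs a
factor `C ^ n`, which `S(n) ^ n` beats for a suitable `n`. -/
theorem isSmallMorphism_balancedActionMap_of_nilpotent (hI : IsTopologicallyNilpotentIdeal I)
    (X : Type u) [NormedAddCommGroup X] [NormedSpace ℂ X] [CompleteSpace X]
    [Module A X] [IsScalarTower ℂ A X] [IsBoundedSMul A X] :
    IsSmallMorphism (balancedActionMap I X) := by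
  intro Y _ _ _ _ _ _ φ hφ
  obtain ⟨C, hC0, hC⟩ := ((φ.coprod (balancedActionMap I X)).restrictScalars ℂ).exists_preimage_norm_le hφ
  have hstep : ∀ f : X →+ ℝ, Continuous f → ∀ D M : ℝ, 0 ≤ D → 0 ≤ M →
      (∀ y, |f (φ y)| ≤ D * ‖y‖) →
      (∀ a ∈ I, ‖a‖ ≤ 1 → ∀ x, |f (a • x)| ≤ M * ‖x‖) → ∀ x, |f x| ≤ (C * D + C * M) * ‖x‖ := by
    intro f hf D M hD hM hφ h x
    obtain ⟨⟨y, z⟩, rfl, hyz⟩ := hC x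
    set x := ((φ.coprod (balancedActionMap I X)).restrictScalars ℂ) (y, z) with hx
    have hx' : x = φ y + balancedActionMap I X z := rfl
    have hy : ‖y‖ ≤ C * ‖x‖ := (norm_fst_le (y, z)).trans hyz
    have hz : ‖z‖ ≤ C * ‖x‖ := (norm_snd_le (y, z)).trans hyz
    calc |f x| ≤ |f (φ y)| + |f (balancedActionMap I X z)| := by
          rw [hx', map_add]; exact abs_add_le _ _
      _ ≤ D * ‖y‖ + M * ‖z‖ :=
          add_le_add (hφ y) (abs_comp_balancedActionMap_le I f hf hM h z)
      _ ≤ D * (C * ‖x‖) + M * (C * ‖x‖) := by gcongr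
      _ = _ := by ring
  obtain ⟨n, hn0, hn⟩ : ∃ n : ℕ, n ≠ 0 ∧ C * nilpotenceRate I n ≤ 1 / 2 := by
    have h1 : Filter.Tendsto (fun n => C * nilpotenceRate I n) Filter.atTop (nhds 0) := by
      simpa using Filter.Tendsto.const_mul C hI
    obtain ⟨n, h2, h3⟩ := ((h1.eventually_le_const (by norm_num : (0 : ℝ) < 1 / 2)).and
      (Filter.eventually_ne_atTop 0)).exists
    exact ⟨n, h3, h2⟩
  obtain ⟨K, hK0, hK⟩ := abs_le_of_translate_bound I φ hC0.le hstep n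
  have hpow : C ^ n * nilpotenceRate I n ^ n ≤ 1 / 2 := by
    rw [← mul_pow]
    have h0 : 0 ≤ C * nilpotenceRate I n := mul_nonneg hC0.le (nilpotenceRate_nonneg I n)
    exact (pow_le_of_le_one h0 (hn.trans (by norm_num)) hn0).trans hn
  -- The constant comes from `‖f‖ ≤ K D + ‖f‖ / 2`.
  refine ((φ.restrictScalars ℂ).restrictScalars ℝ).surjective_of_dual_bound (2 * K) fun f => ?_
  set D := ‖f.comp ((φ.restrictScalars ℂ).restrictScalars ℝ)‖ with hD
  have hle : ‖f‖ ≤ K * D + C ^ n * (‖f‖ * nilpotenceRate I n ^ n) := by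
    refine f.opNorm_le_bound ?_ ?_
    · have := nilpotenceRate_nonneg I n
      positivity
    refine hK (f : X →+ ℝ) f.continuous D _ (norm_nonneg _)
      (mul_nonneg (norm_nonneg f) (pow_nonneg (nilpotenceRate_nonneg I n) n)) (fun y => ?_)
      (fun r hr x => ?_)
    · exact (f.comp ((φ.restrictScalars ℂ).restrictScalars ℝ)).le_opNorm y
    · refine (f.le_opNorm _).trans ?_
      rw [mul_assoc]
      refine mul_le_mul_of_nonneg_left ((norm_smul_le _ x).trans ?_) (norm_nonneg f)
      exact mul_le_mul_of_nonneg_right (norm_prod_ofFn_le_nilpotenceRate_pow I hn0 r hr)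
        (norm_nonneg x)
  nlinarith [norm_nonneg f]

end SmallOfNilpotent

/-! ### The free Banach module `A ⊗̂ ℓ¹` and its universal property -/

section FreeModule

namespace EllOne

theorem hasSum_norm (ξ : EllOne) : HasSum (fun k => ‖ξ k‖) ‖ξ‖ := by
  simpa using lp.hasSum_norm (p := 1) (by norm_num) ξ

variable {Y : Type*} [NormedAddCommGroup Y] [NormedSpace ℂ Y]

theorem summable_smul [CompleteSpace Y] (y : ℕ → Y) {M : ℝ} (hM : ∀ k, ‖y k‖ ≤ M) (ξ : EllOne) :
    Summable fun k => ξ k • y k :=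
  .of_norm_bounded ((hasSum_norm ξ).summable.mul_right M) fun k => by
    rw [norm_smul]; exact mul_le_mul_of_nonneg_left (hM k) (norm_nonneg _)

/-- The linear map `ξ ↦ ∑ ξₖ yₖ` on `ℓ¹` for a bounded sequence `y`. -/
def combination [CompleteSpace Y] (y : ℕ → Y) {M : ℝ} (hM : ∀ k, ‖y k‖ ≤ M) : EllOne →ₗ[ℂ] Y where
  toFun ξ := ∑' k, ξ k • y k
  map_add' ξ η := by
    rw [← (summable_smul y hM ξ).tsum_add (summable_smul y hM η)]
    exact tsum_congr fun k => add_smul _ _ _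
  map_smul' c ξ := by
    rw [RingHom.id_apply, ← (summable_smul y hM ξ).tsum_const_smul]
    exact tsum_congr fun k => mul_smul _ _ _

theorem norm_combination_le [CompleteSpace Y] (y : ℕ → Y) {M : ℝ} (hM : ∀ k, ‖y k‖ ≤ M)
    (ξ : EllOne) : ‖combination y hM ξ‖ ≤ M * ‖ξ‖ := by
  rw [mul_comm]
  refine tsum_of_norm_bounded ((hasSum_norm ξ).mul_right M) fun k => ?_
  rw [norm_smul]; exact mul_le_mul_of_nonneg_left (hM k) (norm_nonneg _)

/-- The standard unit vector `eₖ` of `ℓ¹`. -/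
def basis (k : ℕ) : EllOne := lp.single 1 k (1 : ℂ)

theorem norm_basis (k : ℕ) : ‖basis k‖ = 1 := by
  rw [basis, lp.norm_single one_pos, norm_one]

theorem combination_basis [CompleteSpace Y] (y : ℕ → Y) {M : ℝ} (hM : ∀ k, ‖y k‖ ≤ M) (k : ℕ) :
    combination y hM (basis k) = y k := by
  refine (tsum_eq_single k fun j hj => ?_).trans ?_
  · rw [basis, lp.single_apply_ne _ _ _ hj, zero_smul]
  · rw [basis, lp.single_apply_self, one_smul]

theorem hasSum_basis (ξ : EllOne) : HasSum (fun k => ξ k • basis k) ξ := by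
  have h := lp.hasSum_single (p := 1) (by norm_num) ξ
  refine h.congr_fun fun k => ?_
  rw [basis, ← lp.single_smul, smul_eq_mul, mul_one]

end EllOne

@[elab_as_elim]
theorem AlgTensor.induction_on {E F : Type*} [NormedAddCommGroup E] [NormedSpace ℂ E]
    [NormedAddCommGroup F] [NormedSpace ℂ F] {p : AlgTensor E F → Prop} (t : AlgTensor E F)
    (zero : p 0) (tmul : ∀ x y, p (tmul x y)) (add : ∀ s t, p s → p t → p (s + t)) : p t :=
  TensorProduct.induction_on (motive := p) t zero tmul add

namespace ProjTensor

variable {A : Type*} [NormedRing A] [NormedAlgebra ℂ A]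

section Ext

variable {E F Z : Type*} [NormedAddCommGroup E] [NormedSpace ℂ E] [NormedAddCommGroup F]
  [NormedSpace ℂ F] [Module A E] [IsScalarTower ℂ A E] [IsBoundedSMul A E]
  [NormedAddCommGroup Z] [Module A Z]

theorem norm_tmul_le (x : E) (y : F) : ‖tmul x y‖ ≤ ‖x‖ * ‖y‖ :=
  (UniformSpace.Completion.norm_coe _).trans_le (AlgTensor.projNorm_tmul_le x y)

theorem smul_tmul (a : A) (x : E) (y : F) : a • tmul x y = tmul (a • x) y := by
  rw [tmul, tmul, ← UniformSpace.Completion.coe_smul, AlgTensor.smul_tmul]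

/-- `y ↦ x ⊗ y` as a bounded linear map. -/
def tmulRight (F : Type*) [NormedAddCommGroup F] [NormedSpace ℂ F] (x : E) :
    F →L[ℂ] ProjTensor E F :=
  LinearMap.mkContinuous
    { toFun := fun y => tmul x y
      map_add' := fun y z => by
        rw [tmul, tmul, tmul, ← UniformSpace.Completion.coe_add]
        exact congrArg _ (TensorProduct.tmul_add x y z)
      map_smul' := fun c y => by
        rw [tmul, tmul, RingHom.id_apply, ← UniformSpace.Completion.coe_smul]
        exact congrArg _ (TensorProduct.tmul_smul c x y) } ‖x‖ (norm_tmul_le x)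

theorem tmulRight_apply (x : E) (y : F) : tmulRight F x y = tmul x y := rfl

theorem hom_ext {f g : ProjTensor E F →L[A] Z} (h : ∀ x y, f (tmul x y) = g (tmul x y)) :
    f = g := by
  ext w
  induction w using UniformSpace.Completion.induction_on with
  | hp => exact isClosed_eq f.continuous g.continuous
  | ih t =>
    induction t using AlgTensor.induction_on with
    | zero => exact (map_zero f).trans (map_zero g).symm
    | tmul x y => exact h x y
    | add s t hs ht => rw [UniformSpace.Completion.coe_add, map_add, map_add, hs, ht]

end Ext

variable {Z : Type*} [NormedAddCommGroup Z] [NormedSpace ℂ Z] [Module A Z] [IsScalarTower ℂ A Z]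

/-- The `1 ⊗ eₖ` generate a dense submodule: `a ⊗ ξ = a • (1 ⊗ ξ)`, and `ξ = ∑ ξₖ eₖ` converges in
`ℓ¹`. -/
theorem hom_ext_basis {f g : ProjTensor A EllOne →L[A] Z}
    (h : ∀ k, f (tmul 1 (EllOne.basis k)) = g (tmul 1 (EllOne.basis k))) : f = g := by
  refine hom_ext fun a ξ => ?_
  have h1 : tmul a ξ = a • tmulRight EllOne (1 : A) ξ := by
    rw [tmulRight_apply, smul_tmul, smul_eq_mul, mul_one]
  rw [h1, map_smul, map_smul]
  congr 1
  refine (((f.restrictScalars ℂ).comp (tmulRight EllOne (1 : A))).hasSum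
    (EllOne.hasSum_basis ξ)).unique ?_
  refine (((g.restrictScalars ℂ).comp (tmulRight EllOne (1 : A))).hasSum
    (EllOne.hasSum_basis ξ)).congr_fun fun k => ?_
  simp only [map_smul]
  congr 1
  exact h k

variable [IsBoundedSMul A Z] [CompleteSpace Z]

/-- The algebraic map `a ⊗ ξ ↦ ∑ ξₖ a • yₖ` for a bounded sequence `y`. -/
def freeLiftAlg (y : ℕ → Z) {M : ℝ} (hM : ∀ k, ‖y k‖ ≤ M) : AlgTensor A EllOne →ₗ[A] Z :=
  TensorProduct.AlgebraTensorModule.lift (R := ℂ) (A := A) (M := A) (N := EllOne) (P := Z)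
    { toFun := fun a =>
        { toFun := fun ξ => a • EllOne.combination y hM ξ
          map_add' := fun ξ η => by rw [map_add, smul_add]
          map_smul' := fun c ξ => by rw [map_smul, RingHom.id_apply, smul_comm] }
      map_add' := fun a b => by ext ξ; exact add_smul _ _ _
      map_smul' := fun b a => by ext ξ; exact mul_smul _ _ _ }

theorem norm_freeLiftAlg_tmul_le (y : ℕ → Z) {M : ℝ} (hM : ∀ k, ‖y k‖ ≤ M) (a : A) (ξ : EllOne) :
    ‖freeLiftAlg y hM (AlgTensor.tmul a ξ)‖ ≤ M * (‖a‖ * ‖ξ‖) := by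
  change ‖a • EllOne.combination y hM ξ‖ ≤ _
  rw [mul_left_comm]
  exact (norm_smul_le a _).trans
    (mul_le_mul_of_nonneg_left (EllOne.norm_combination_le y hM ξ) (norm_nonneg a))

/-- The morphism `a ⊗ ξ ↦ ∑ ξₖ a • yₖ` from the free module `A ⊗̂ ℓ¹` given by a bounded
sequence `y`. -/
def freeLift (y : ℕ → Z) (M : ℝ) (hM0 : 0 ≤ M) (hM : ∀ k, ‖y k‖ ≤ M) : ProjTensor A EllOne →L[A] Z :=
  lift (freeLiftAlg y hM) M hM0 (norm_freeLiftAlg_tmul_le y hM)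

theorem freeLift_basis (y : ℕ → Z) (M : ℝ) (hM0 : 0 ≤ M) (hM : ∀ k, ‖y k‖ ≤ M) (k : ℕ) :
    freeLift (A := A) y M hM0 hM (tmul 1 (EllOne.basis k)) = y k :=
  (lift_coe ..).trans <| (one_smul A _).trans (EllOne.combination_basis y hM k)

theorem norm_freeLift_apply_le (y : ℕ → Z) (M : ℝ) (hM0 : 0 ≤ M) (hM : ∀ k, ‖y k‖ ≤ M)
    (w : ProjTensor A EllOne) : ‖freeLift y M hM0 hM w‖ ≤ M * ‖w‖ := by
  induction w using UniformSpace.Completion.induction_on with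
  | hp =>
    exact isClosed_le (freeLift y M hM0 hM).continuous.norm (continuous_const.mul continuous_norm)
  | ih t =>
    rw [UniformSpace.Completion.norm_coe, freeLift, lift_coe]
    exact AlgTensor.norm_map_le _ hM0 (norm_freeLiftAlg_tmul_le y hM) t

end ProjTensor

/-- The free Banach module `A ⊗̂ ℓ¹` is strictly projective. -/
theorem isStrictlyProjective_projTensor_ellOne (A : Type u) [NormedRing A] [NormedAlgebra ℂ A]
    [CompleteSpace A] : IsStrictlyProjective A (ProjTensor A EllOne) := by
  intro Y _ _ _ _ _ _ ε hε
  obtain ⟨C, hC0, hC⟩ := (ε.restrictScalars ℂ).exists_preimage_norm_le hε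
  -- The open mapping theorem lifts all basis vectors with one common bound, which is what a
  -- morphism out of the free module requires.
  choose y hy hyC using fun k => hC (ProjTensor.tmul 1 (EllOne.basis k))
  have hM : ∀ k, ‖y k‖ ≤ C * ‖(1 : A)‖ := fun k =>
    (hyC k).trans (mul_le_mul_of_nonneg_left ((ProjTensor.norm_tmul_le _ _).trans_eq
      (by rw [EllOne.norm_basis, mul_one])) hC0.le)
  refine ⟨ProjTensor.freeLift y (C * ‖(1 : A)‖) (by positivity) hM,
    ProjTensor.hom_ext_basis fun k => ?_⟩
  exact (congrArg ε (ProjTensor.freeLift_basis ..)).trans (hy k)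

end FreeModule

/-! ### From `I ⊗̂_A P → P` with `P` free to `ι ⊗ 1` -/

section Reduction

variable {A : Type u} [NormedRing A] [NormedAlgebra ℂ A]

/-- The surjectivity condition on `Y ⊕ X₀ → X` sees `ψ` only through its range, and a larger range
makes it easier to satisfy. -/
theorem IsSmallMorphism.of_range_subset {X₀ X₁ X : Type u}
    [NormedAddCommGroup X₀] [NormedSpace ℂ X₀] [CompleteSpace X₀]
    [Module A X₀] [IsScalarTower ℂ A X₀] [IsBoundedSMul A X₀]
    [NormedAddCommGroup X₁] [NormedSpace ℂ X₁] [CompleteSpace X₁]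
    [Module A X₁] [IsScalarTower ℂ A X₁] [IsBoundedSMul A X₁]
    [NormedAddCommGroup X] [NormedSpace ℂ X] [CompleteSpace X]
    [Module A X] [IsScalarTower ℂ A X] [IsBoundedSMul A X]
    {ψ : X₀ →L[A] X} {ψ' : X₁ →L[A] X} (h : IsSmallMorphism ψ)
    (hr : Set.range ψ' ⊆ Set.range ψ) : IsSmallMorphism ψ' := by
  intro Y _ _ _ _ _ _ φ hφ
  refine h Y φ fun x => ?_
  obtain ⟨⟨y, z⟩, rfl⟩ := hφ x
  obtain ⟨w, hw⟩ := hr ⟨z, rfl⟩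
  exact ⟨(y, w), congrArg (φ y + ·) hw⟩

variable (I : Ideal A)

/-- The map `ι ⊗ 1` factors through the action on `P = A ⊗̂ ℓ¹` via `a ⊗ ξ ↦ a ⊗ (1 ⊗ ξ)`. For
smallness this suffices; no identification of `I ⊗̂_A P` with `I ⊗̂ ℓ¹` is needed. -/
theorem range_inclusionTensor_subset : Set.range (inclusionTensor I EllOne) ⊆
    Set.range (balancedActionMap I (ProjTensor A EllOne)) := by
  let P := ProjTensor A EllOne
  let j : AlgTensor I EllOne →ₗ[A] ProjTensor I P :=
    (UniformSpace.Completion.toComplL (𝕜 := A) (E := AlgTensor I P)).toLinearMap.comp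
      (TensorProduct.AlgebraTensorModule.map (R := ℂ) (A := A) LinearMap.id
        (ProjTensor.tmulRight EllOne (1 : A)).toLinearMap : AlgTensor I EllOne →ₗ[A] AlgTensor I P)
  have hj : ∀ a ξ, j (AlgTensor.tmul a ξ) = ProjTensor.tmul a (ProjTensor.tmul (1 : A) ξ) :=
    fun _ _ => rfl
  let J : ProjTensor I EllOne →L[A] ProjTensor I P :=
    ProjTensor.lift j ‖(1 : A)‖ (norm_nonneg _) fun a ξ => by
      rw [hj, mul_left_comm]
      exact (ProjTensor.norm_tmul_le _ _).trans
        (mul_le_mul_of_nonneg_left (ProjTensor.norm_tmul_le _ _) (norm_nonneg a))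
  have hJ : (actionMap I P).comp J = inclusionTensor I EllOne := by
    refine ProjTensor.hom_ext fun a ξ => ?_
    have h1 : J (ProjTensor.tmul a ξ) = ProjTensor.tmul a (ProjTensor.tmul (1 : A) ξ) :=
      (ProjTensor.lift_coe ..).trans (hj a ξ)
    rw [ContinuousLinearMap.comp_apply, h1, actionMap_tmul, inclusionTensor_tmul,
      ProjTensor.smul_tmul, smul_eq_mul, mul_one]
  rintro _ ⟨w, rfl⟩
  exact ⟨Submodule.Quotient.mk (J w), DFunLike.congr_fun hJ w⟩

end Reduction

/-! ### Smallness of `ι ⊗ 1` implies topological nilpotence -/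

section Converse

variable {A : Type u} [NormedRing A] [NormedAlgebra ℂ A]

/-- The coordinate morphism `a ⊗ ξ ↦ ξⱼ a` on the free module `A ⊗̂ ℓ¹`. -/
def ProjTensor.coord [CompleteSpace A] (j : ℕ) : ProjTensor A EllOne →L[A] A :=
  ProjTensor.freeLift (fun k => if k = j then 1 else 0) ‖(1 : A)‖ (norm_nonneg _) fun k => by
    split_ifs <;> simp

theorem ProjTensor.coord_basis [CompleteSpace A] (j k : ℕ) :
    ProjTensor.coord j (ProjTensor.tmul (1 : A) (EllOne.basis k)) = if k = j then 1 else 0 :=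
  ProjTensor.freeLift_basis ..

theorem ProjTensor.norm_coord_le [CompleteSpace A] (j : ℕ) (w : ProjTensor A EllOne) :
    ‖ProjTensor.coord j w‖ ≤ ‖(1 : A)‖ * ‖w‖ :=
  ProjTensor.norm_freeLift_apply_le ..

/-- If `I ⊗̂ ℓ¹ → A ⊗̂ ℓ¹` is small then the finite products of any bounded double sequence
in `I` are bounded. The free module has basis `e (n, i)`, and the morphism
`e (n, i) ↦ e (n, i) - r n i • e (n, i + 1)` is onto. -/
theorem exists_bound_prod_of_isSmallMorphism [CompleteSpace A] (I : Ideal A)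
    (hI : IsClosed (I : Set A)) (h : IsSmallMorphism (inclusionTensor I EllOne)) (r : ℕ → ℕ → I) (C : ℝ)
    (hC0 : 0 ≤ C) (hC : ∀ n i, ‖r n i‖ ≤ C) :
    ∃ K : ℝ, ∀ n, ‖(List.ofFn fun i : Fin n => (r n i : A)).prod‖ ≤ K := by
  have : CompleteSpace I := hI.completeSpace_coe
  -- The pairs `(n, i)` are coded as indices `k` of `ℓ¹`; `s` moves one step along row `n`, and `ρ`
  -- is the weight of that step.
  let s : ℕ → ℕ := fun k => Nat.pair k.unpair.1 (k.unpair.2 + 1)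
  let ρ : ℕ → I := fun k => r k.unpair.1 k.unpair.2
  let R : ProjTensor A EllOne →L[A] ProjTensor I EllOne :=
    ProjTensor.freeLift (fun k => ProjTensor.tmul (ρ k) (EllOne.basis (s k))) C hC0 fun k =>
      (ProjTensor.norm_tmul_le _ _).trans (by rw [EllOne.norm_basis, mul_one]; exact hC _ _)
  let T : ProjTensor A EllOne →L[A] ProjTensor A EllOne := (inclusionTensor I EllOne).comp R
  have hT : ∀ k, T (ProjTensor.tmul 1 (EllOne.basis k)) =
      (ρ k : A) • ProjTensor.tmul (1 : A) (EllOne.basis (s k)) := by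
    intro k
    have h1 : R (ProjTensor.tmul 1 (EllOne.basis k)) =
      ProjTensor.tmul (ρ k) (EllOne.basis (s k)) := ProjTensor.freeLift_basis ..
    rw [ContinuousLinearMap.comp_apply, h1, inclusionTensor_tmul, ProjTensor.smul_tmul,
      smul_eq_mul, mul_one]
  let φ : ProjTensor A EllOne →L[A] ProjTensor A EllOne := ContinuousLinearMap.id A _ - T
  -- Every `x` equals `φ x + (ι ⊗ 1) (R x)`, so smallness applies.
  have hsurj : Function.Surjective φ :=
    h _ φ fun x => ⟨(x, R x), sub_add_cancel x (T x)⟩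
  obtain ⟨K, hK0, hK⟩ := (φ.restrictScalars ℂ).exists_preimage_norm_le hsurj
  have hs : ∀ k l, s k = s l ↔ k = l := by
    intro k l
    refine ⟨fun hkl => ?_, congrArg s⟩
    have h1 := congrArg Nat.unpair hkl
    simp only [s, Nat.unpair_pair, Prod.mk.injEq, add_left_inj] at h1
    rw [← Nat.pair_unpair k, ← Nat.pair_unpair l, h1.1, h1.2]
  have hsucc : ∀ n i, s (Nat.pair n i) = Nat.pair n (i + 1) := fun n i => by
    simp only [s, Nat.unpair_pair]
  have hρ : ∀ n i, ρ (Nat.pair n i) = r n i := fun n i => by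
    simp only [ρ, Nat.unpair_pair]
  -- Coordinates are left `A`-linear, so the weight appears on the right; this makes the products
  -- below come out in the order `r n 0, r n 1, …`.
  have hcoord : ∀ k w, ProjTensor.coord (s k) (T w) = ProjTensor.coord k w * (ρ k : A) := by
    intro k w
    suffices h0 : (ProjTensor.coord (s k)).comp T =
        (ContinuousLinearMap.toSpanSingleton A (ρ k : A)).comp (ProjTensor.coord k) from
      DFunLike.congr_fun h0 w
    refine ProjTensor.hom_ext_basis fun l => ?_
    rw [ContinuousLinearMap.comp_apply, hT, map_smul, ProjTensor.coord_basis,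
      ContinuousLinearMap.comp_apply, ProjTensor.coord_basis,
      ContinuousLinearMap.toSpanSingleton_apply]
    by_cases hkl : l = k
    · simp [hkl]
    · simp [hkl, hs]
  -- No step of `s` ends at the start of a row.
  have hcoord0 : ∀ n w, ProjTensor.coord (Nat.pair n 0) (T w) = 0 := by
    intro n w
    suffices h0 : (ProjTensor.coord (Nat.pair n 0)).comp T = 0 from DFunLike.congr_fun h0 w
    refine ProjTensor.hom_ext_basis fun k => ?_
    rw [ContinuousLinearMap.comp_apply, hT, map_smul, ProjTensor.coord_basis, if_neg, smul_zero]
    · rfl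
    · intro hk
      have h1 := congrArg (fun m => m.unpair.2) hk
      simp [s] at h1
  -- One factor `‖1‖` bounds the basis vector, the other the coordinate map; `K` is the open mapping
  -- constant of `φ`, hence the same for all rows.
  refine ⟨‖(1 : A)‖ * (K * ‖(1 : A)‖), fun n => ?_⟩
  obtain ⟨v, hv, hvK⟩ := hK (ProjTensor.tmul 1 (EllOne.basis (Nat.pair n 0)))
  replace hv : v - T v = ProjTensor.tmul 1 (EllOne.basis (Nat.pair n 0)) := hv
  -- Comparing coordinates in `v - T v = e (n, 0)` gives `1` at the start of row `n` and then right
  -- multiplication by `r n i` at each step.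
  have hprod : ∀ i : ℕ, ProjTensor.coord (Nat.pair n i) v =
      (List.ofFn fun j : Fin i => (r n j : A)).prod := by
    intro i
    induction i with
    | zero =>
      have h1 := congrArg (ProjTensor.coord (Nat.pair n 0)) hv
      rw [map_sub, hcoord0, sub_zero, ProjTensor.coord_basis, if_pos rfl] at h1
      simpa using h1
    | succ i ih =>
      have h1 := congrArg (ProjTensor.coord (s (Nat.pair n i))) hv
      rw [map_sub, hcoord, ih, hsucc, hρ, ProjTensor.coord_basis, if_neg (by simp),
        sub_eq_zero] at h1
      rw [h1, List.ofFn_succ_last]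
      simp
  rw [← hprod n]
  refine (ProjTensor.norm_coord_le _ v).trans (mul_le_mul_of_nonneg_left (hvK.trans ?_)
    (norm_nonneg _))
  refine mul_le_mul_of_nonneg_left ((ProjTensor.norm_tmul_le _ _).trans_eq ?_) hK0.le
  rw [EllOne.norm_basis, mul_one]

/-- Scaling the entries by `C` keeps them bounded and multiplies an `n`-fold product by `C ^ n`, so
bounded products for every `C` give the required criterion. -/
theorem isTopologicallyNilpotentIdeal_of_isSmallMorphism [CompleteSpace A] (I : Ideal A)
    (hI : IsClosed (I : Set A)) (h : IsSmallMorphism (inclusionTensor I EllOne)) :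
    IsTopologicallyNilpotentIdeal I := by
  refine isTopologicallyNilpotentIdeal_of_bounded I fun C hC r hr => ?_
  have hmem : ∀ a ∈ I, (C : ℂ) • a ∈ I := fun a ha => by
    rw [← smul_one_mul (C : ℂ) a]; exact I.mul_mem_left _ ha
  -- Row `n` holds the scaled `n`-tuple, padded by zeros that do not enter its `n`-fold product.
  let r' : ℕ → ℕ → I := fun n i =>
    if hi : i < n then ⟨(C : ℂ) • r n ⟨i, hi⟩, hmem _ (hr n _).1⟩ else 0
  obtain ⟨K, hK⟩ := exists_bound_prod_of_isSmallMorphism I hI h r' C hC.le fun n i => by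
    by_cases hi : i < n
    · simp only [r', dif_pos hi]
      change ‖(C : ℂ) • r n ⟨i, hi⟩‖ ≤ C
      rw [norm_smul, Complex.norm_real, Real.norm_of_nonneg hC.le]
      exact mul_le_of_le_one_right hC.le (hr n _).2
    · simp only [r', dif_neg hi, norm_zero, hC.le]
  have hscale : ∀ (m : ℕ) (t : Fin m → A),
      (List.ofFn fun i => (C : ℂ) • t i).prod = (C : ℂ) ^ m • (List.ofFn t).prod := by
    intro m
    induction m with
    | zero => simp
    | succ m ih =>
      intro t
      rw [List.ofFn_succ, List.ofFn_succ, List.prod_cons, List.prod_cons, ih, smul_mul_smul_comm,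
        pow_succ']
  refine ⟨K, fun n => ?_⟩
  have h1 := hK n
  have h2 : (fun i : Fin n => (r' n i : A)) = fun i => (C : ℂ) • r n i := by
    funext i
    simp [r']
  rwa [h2, hscale, norm_smul, norm_pow, Complex.norm_real, Real.norm_of_nonneg hC.le] at h1

end Converse

end

/-! ### The cycle of implications -/

theorem mainTheorem4 {A : Type u} [NormedRing A] [NormedAlgebra ℂ A] [CompleteSpace A]
    (I : Ideal A) (hI : IsClosed (I : Set A)) :
    List.TFAE [
      IsTopologicallyNilpotentIdeal I,
      ∀ (X : Type u) [NormedAddCommGroup X] [NormedSpace ℂ X] [CompleteSpace X]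
        [Module A X] [IsScalarTower ℂ A X] [IsBoundedSMul A X],
        IsSmallMorphism (balancedActionMap I X),
      ∀ (P : Type u) [NormedAddCommGroup P] [NormedSpace ℂ P] [CompleteSpace P]
        [Module A P] [IsScalarTower ℂ A P] [IsBoundedSMul A P],
        IsStrictlyProjective A P → IsSmallMorphism (balancedActionMap I P),
      IsSmallMorphism (inclusionTensor I EllOne)] := by
  tfae_have 1 → 2 := fun h X => isSmallMorphism_balancedActionMap_of_nilpotent I h X
  tfae_have 2 → 3 := fun h P _ _ _ _ _ _ _ => h P
  tfae_have 3 → 4 := fun h =>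
    (h _ (isStrictlyProjective_projTensor_ellOne A)).of_range_subset (range_inclusionTensor_subset I)
  tfae_have 4 → 1 := isTopologicallyNilpotentIdeal_of_isSmallMorphism I hI
  tfae_finish
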